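/- Let $k\in[0,1)$, $\lambda>0$ and $s\ge 1$. Put $\nu=\frac{1}{2(1-k)}$ and $\phi_k(t)=\frac{t^{1-k}}{1-k}$ for $t>0$, and let $\mathrm I_\mu,\mathrm K_\mu$ denote the modified Bessel functions of order $\mu$ of the first and second kind. For $t\ge s$ define $$y_0(t,s;\lambda,k)=\lambda\,(t/s)^{1/2}\,\phi_k(s)\big[\mathrm I_{\nu-1}(\lambda\phi_k(s))\,\mathrm K_{\nu}(\lambda\phi_k(t))+\mathrm K_{\nu-1}(\lambda\phi_k(s))\,\mathrm I_{\nu}(\lambda\phi_k(t))\big],$$ $$y_1(t,s;\lambda,k)=(1-k)^{-1}(st)^{1/2}\big[\mathrm K_{\nu}(\lambda\phi_k(s))\,\mathrm I_{\nu}(\lambda\phi_k(t))-\mathrm I_{\nu}(\lambda\phi_k(s))\,\mathrm K_{\nu}(\lambda\phi_k(t))\big].$$ Then $y_0(\cdot,s;\lambda,k)$ is the unique solution on $[s,\infty)$ of the Cauchy problem $y''(t)-\lambda^2t^{-2k}y(t)=0$ for $t>s$, $y(s)=1$, $y'(s)=0$, and $y_1(\cdot,s;\lambda,k)$ is the unique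 solution on $[s,\infty)$ of the Cauchy problem $y''(t)-\lambda^2t^{-2k}y(t)=0$ for $t>s$, $y(s)=0$, $y'(s)=1$. Here a solution is a real-valued function that is $C^1$ on $[s,\infty)$, with the one-sided derivative at $s$, and twice differentiable on $(s,\infty)$. -/

import Mathlib

noncomputable section

namespace EdeS

/-- Modified Bessel function of the first kind of real order `ν` at `x > 0`:
`I_ν(x) = ∑ₘ (x/2)^(2m+ν) / (m! Γ(m+ν+1))`. At a pole of `Γ` Mathlib sets `Real.Gamma` to be `0`,
so that the summand is then `0`, in agreement with the convention that `1/Γ` vanishes there. -/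
def besselI (ν x : ℝ) : ℝ :=
  ∑' m : ℕ, (x / 2) ^ (2 * (m : ℝ) + ν) / ((m.factorial : ℝ) * Real.Gamma ((m : ℝ) + ν + 1))

/-- Modified Bessel function of the second kind (Macdonald function) of real order `ν` at `x > 0`,
for all orders, integer or not: `K_ν(x) = ∫₀^∞ exp(-x cosh u) cosh(ν u) du`. -/
def besselK (ν x : ℝ) : ℝ :=
  ∫ u in Set.Ioi (0 : ℝ), Real.exp (-x * Real.cosh u) * Real.cosh (ν * u)

/-- `φ_k(t) = t^(1-k) / (1-k)`. -/
def phi (k t : ℝ) : ℝ := t ^ (1 - k) / (1 - k)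

/-- `ν = 1 / (2(1-k))`. -/
def nu (k : ℝ) : ℝ := 1 / (2 * (1 - k))

/-- The function `y₀(t, s; lam, k)`. -/
def y0 (lam k s t : ℝ) : ℝ :=
  lam * (t / s) ^ (1 / 2 : ℝ) * phi k s *
    (besselI (nu k - 1) (lam * phi k s) * besselK (nu k) (lam * phi k t) +
      besselK (nu k - 1) (lam * phi k s) * besselI (nu k) (lam * phi k t))

/-- The function `y₁(t, s; lam, k)`. -/
def y1 (lam k s t : ℝ) : ℝ :=
  (1 - k)⁻¹ * (s * t) ^ (1 / 2 : ℝ) *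
    (besselK (nu k) (lam * phi k s) * besselI (nu k) (lam * phi k t) -
      besselI (nu k) (lam * phi k s) * besselK (nu k) (lam * phi k t))

/-- `y` is a classical solution of `y'' - lam² t^(-2k) y = 0` for `t > s`, with `y(s) = a` and
`y'(s) = b`: it is `C¹` on `[s, ∞)` (one-sided derivative at `s`), twice differentiable on
`(s, ∞)`, and satisfies the equation there. Only the values of `y` on `[s, ∞)` matter. -/
def IsCauchySolution (lam k s a b : ℝ) (y : ℝ → ℝ) : Prop :=
  ∃ y' y'' : ℝ → ℝ,
    (∀ t, s ≤ t → HasDerivWithinAt y (y' t) (Set.Ici s) t) ∧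
    ContinuousOn y' (Set.Ici s) ∧
    (∀ t, s < t → HasDerivAt y' (y'' t) t) ∧
    (∀ t, s < t → y'' t - lam ^ 2 * t ^ (-2 * k) * y t = 0) ∧
    y s = a ∧ y' s = b

end EdeS

end

/-! Put x = λφ_k(t), Z = A I_ν + B K_ν and Z₁ = A I_{ν-1} - B K_{ν-1}. The choice of ν makes t^(1/2)
Z(x) and λ t^(1/2-k) Z₁(x) a first-order system equivalent to the equation (`hasDerivAt_sqrt_mul`,
`hasDerivAt_rpow_mul`), by the order-shifting derivative formulas for I (from its series) and K
(from its integral). The initial values then reduce to x (I_{ν-1} K_ν + K_{ν-1} I_ν) = 1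
(`mul_besselI_mul_besselK`): the left side has zero derivative, and its limit at 0+ follows from the
leading asymptotics of I and K. For uniqueness, Wronskians of solutions are constant, so every
solution is the combination of y₀ and y₁ dictated by its initial data. -/

open Filter Topology MeasureTheory

namespace EdeS

/-! ### Power series and the function I. -/

/-- The general term of the series `∑ₘ z^m / (m! Γ(m+a))`. -/
noncomputable def hyperTerm (a z : ℝ) (m : ℕ) : ℝ :=
  z ^ m / ((m.factorial : ℝ) * Real.Gamma ((m : ℝ) + a))

/-- The entire function `∑ₘ z^m / (m! Γ(m+a))`. -/
noncomputable def hyper (a z : ℝ) : ℝ := ∑' m : ℕ, hyperTerm a z m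

lemma Gamma_nat_add_pos {a : ℝ} (ha : 0 < a) (m : ℕ) : 0 < Real.Gamma ((m : ℝ) + a) :=
  Real.Gamma_pos_of_pos (by positivity)

lemma Gamma_nat_add_succ {a : ℝ} (ha : 0 < a) (m : ℕ) :
    Real.Gamma ((m : ℝ) + (a + 1)) = ((m : ℝ) + a) * Real.Gamma ((m : ℝ) + a) := by
  rw [← add_assoc, Real.Gamma_add_one (by positivity)]

/-- The factor m + 1 cancels in (m+1)!, so weighting by the index raises the parameter by one. -/
lemma succ_mul_hyperTerm_succ (a z : ℝ) (m : ℕ) :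
    ((m : ℝ) + 1) * hyperTerm a z (m + 1) = z * hyperTerm (a + 1) z m := by
  unfold hyperTerm
  rw [Nat.factorial_succ, pow_succ]
  push_cast
  rw [show (m : ℝ) + 1 + a = m + (a + 1) by ring]
  have : (m : ℝ) + 1 ≠ 0 := by positivity
  field_simp

lemma hyperTerm_eq_add {a : ℝ} (ha : 0 < a) (z : ℝ) (m : ℕ) :
    hyperTerm a z m = (m : ℝ) * hyperTerm (a + 1) z m + a * hyperTerm (a + 1) z m := by
  unfold hyperTerm
  rw [Gamma_nat_add_succ ha]
  have h := (Gamma_nat_add_pos ha m).ne'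
  have h' : (m : ℝ) + a ≠ 0 := by positivity
  field_simp

lemma summable_hyperTerm {a : ℝ} (ha : 0 < a) (z : ℝ) : Summable (hyperTerm a z) := by
  refine summable_of_ratio_norm_eventually_le (r := 1 / 2) (by norm_num) ?_
  -- The term ratio is z / ((m+1)(m+a)), and m ≥ 2|z|/a gives 2|z| ≤ m a ≤ (m+1)(m+a).
  obtain ⟨N, hN⟩ := exists_nat_ge (2 * |z| / a)
  filter_upwards [eventually_ge_atTop N] with m hm
  have hm' : (N : ℝ) ≤ m := by exact_mod_cast hm
  have h1 := succ_mul_hyperTerm_succ a z m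
  have h2 := hyperTerm_eq_add ha z m
  have hpos : 0 < (m : ℝ) + 1 := by positivity
  have hpos' : 0 < (m : ℝ) + a := by positivity
  have e : hyperTerm a z (m + 1) = z / (((m : ℝ) + 1) * (m + a)) * hyperTerm a z m := by
    rw [h2]; field_simp; linarith
  rw [e, norm_mul]
  gcongr
  rw [Real.norm_eq_abs, abs_div, abs_of_pos (mul_pos hpos hpos'), div_le_div_iff₀ (by positivity)
    (by norm_num)]
  have h3 : 2 * |z| ≤ m * a := by
    rw [div_le_iff₀ ha] at hN; nlinarith
  have : 0 ≤ (m : ℝ) := by positivity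
  nlinarith

lemma summable_nat_mul_hyperTerm {a : ℝ} (ha : 0 < a) (z : ℝ) :
    Summable fun m : ℕ => (m : ℝ) * hyperTerm a z m := by
  rw [← summable_nat_add_iff 1]
  simp only [Nat.cast_add, Nat.cast_one, succ_mul_hyperTerm_succ]
  exact (summable_hyperTerm (by linarith) z).mul_left z

lemma tsum_nat_mul_hyperTerm {a : ℝ} (ha : 0 < a) (z : ℝ) :
    ∑' m : ℕ, (m : ℝ) * hyperTerm a z m = z * hyper (a + 1) z := by
  rw [(summable_nat_mul_hyperTerm ha z).tsum_eq_zero_add]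
  simp only [Nat.cast_add, Nat.cast_one, succ_mul_hyperTerm_succ, Nat.cast_zero, zero_mul, zero_add]
  rw [tsum_mul_left]; rfl

lemma hyper_recurrence {a : ℝ} (ha : 0 < a) (z : ℝ) :
    hyper a z = z * hyper (a + 2) z + a * hyper (a + 1) z := by
  have h1 : 0 < a + 1 := by linarith
  have := tsum_nat_mul_hyperTerm h1 z
  rw [show a + 2 = a + 1 + 1 by ring, ← this]
  unfold hyper
  rw [← tsum_mul_left, ← (summable_nat_mul_hyperTerm h1 z).tsum_add
    ((summable_hyperTerm h1 z).mul_left a)]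
  exact tsum_congr fun m => hyperTerm_eq_add ha z m

/-- Termwise differentiation on the ball of radius |z| + 1, dominated by the derived series at that
radius. The truncated exponent `m - 1` at `m = 0` is harmless: the factor `m` kills the term. -/
lemma hasDerivAt_hyper {a : ℝ} (ha : 0 < a) (z : ℝ) :
    HasDerivAt (hyper a) (hyper (a + 1) z) z := by
  set R := |z| + 1 with hR
  have hR0 : 0 < R := by positivity
  let g' : ℕ → ℝ → ℝ := fun m y =>
    (m : ℝ) * y ^ (m - 1) / ((m.factorial : ℝ) * Real.Gamma ((m : ℝ) + a))
  have hden : ∀ m : ℕ, 0 < (m.factorial : ℝ) * Real.Gamma ((m : ℝ) + a) := fun m =>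
    mul_pos (by positivity) (Gamma_nat_add_pos ha m)
  have hshift : ∀ (m : ℕ) (y : ℝ), g' (m + 1) y = hyperTerm (a + 1) y m := by
    intro m y
    simp only [g', hyperTerm, Nat.factorial_succ, Nat.add_sub_cancel]
    push_cast
    rw [show (m : ℝ) + 1 + a = m + (a + 1) by ring]
    have : (m : ℝ) + 1 ≠ 0 := by positivity
    field_simp
  have hsum : ∀ y, Summable fun m => g' m y := by
    intro y
    rw [← summable_nat_add_iff 1]
    simp only [hshift]
    exact summable_hyperTerm (by linarith) y
  have key := hasDerivAt_tsum_of_isPreconnected (u := fun m => g' m R) (t := Metric.ball (0 : ℝ) R)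
    (g := fun m y => hyperTerm a y m) (g' := g') (y₀ := z) (y := z) (hsum R) Metric.isOpen_ball
    (convex_ball _ _).isPreconnected
    (fun m y _ => (hasDerivAt_pow m y).div_const _)
    (fun m y hy => by
      have hy' : |y| ≤ R := by simpa using (Metric.mem_ball.1 hy).le
      simp only [g', Real.norm_eq_abs, abs_div, abs_mul, abs_pow, Nat.abs_cast,
        abs_of_pos (Gamma_nat_add_pos ha m)]
      have := Gamma_nat_add_pos ha m
      gcongr)
    (by simp [hR]) (summable_hyperTerm ha z) (by simp [hR])
  rw [(hsum z).tsum_eq_zero_add] at key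
  simp only [hshift] at key
  have h0 : g' 0 z = 0 := by simp [g']
  rw [h0, zero_add] at key
  exact key

lemma hyper_zero (a : ℝ) : hyper a 0 = (Real.Gamma a)⁻¹ := by
  unfold hyper
  rw [tsum_eq_single 0]
  · simp [hyperTerm]
  · intro m hm; simp [hyperTerm, hm]

lemma besselI_eq (ν : ℝ) {x : ℝ} (hx : 0 < x) :
    besselI ν x = (x / 2) ^ ν * hyper (ν + 1) ((x / 2) ^ 2) := by
  unfold besselI hyper
  rw [← tsum_mul_left]
  refine tsum_congr fun m => ?_
  rw [Real.rpow_add (by positivity), hyperTerm, ← pow_mul, add_assoc, mul_div_assoc', mul_comm,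
    ← Real.rpow_natCast]
  push_cast
  rfl

lemma hasDerivAt_besselI_add {ν x : ℝ} (hν : -1 < ν) (hx : 0 < x) :
    HasDerivAt (besselI ν) (ν / x * besselI ν x + besselI (ν + 1) x) x := by
  have h2 : HasDerivAt (fun x : ℝ => (x / 2) ^ 2) _ x := ((hasDerivAt_id x).div_const 2).pow 2
  have h3 : HasDerivAt (fun x : ℝ => hyper (ν + 1) ((x / 2) ^ 2)) _ x :=
    HasDerivAt.comp (h₂ := hyper (ν + 1)) (h := fun x : ℝ => (x / 2) ^ 2) x
      (hasDerivAt_hyper (a := ν + 1) (by linarith) ((x / 2) ^ 2)) h2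
  have h1 : HasDerivAt (fun x : ℝ => (x / 2) ^ ν * hyper (ν + 1) ((x / 2) ^ 2)) _ x :=
    (((hasDerivAt_id x).div_const 2).rpow_const (p := ν) (Or.inl (by simp [hx.ne']))).mul h3
  refine (h1.congr_of_eventuallyEq ?_).congr_deriv ?_
  · filter_upwards [lt_mem_nhds hx] with y hy using besselI_eq ν hy
  · rw [besselI_eq _ hx, besselI_eq _ hx, Real.rpow_add_one (by positivity)]
    simp only [id]
    rw [Real.rpow_sub_one (by positivity)]
    field_simp
    ring_nf

lemma besselI_recurrence {ν x : ℝ} (hν : 0 < ν) (hx : 0 < x) :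
    besselI (ν - 1) x = besselI (ν + 1) x + 2 * ν / x * besselI ν x := by
  rw [besselI_eq _ hx, besselI_eq _ hx, besselI_eq _ hx, Real.rpow_add_one (by positivity),
    Real.rpow_sub_one (by positivity), sub_add_cancel, hyper_recurrence hν,
    show ν + 1 + 1 = ν + 2 by ring]
  field_simp

lemma hasDerivAt_besselI_sub {ν x : ℝ} (hν : 0 < ν) (hx : 0 < x) :
    HasDerivAt (besselI ν) (besselI (ν - 1) x - ν / x * besselI ν x) x := by
  refine (hasDerivAt_besselI_add (by linarith) hx).congr_deriv ?_
  rw [besselI_recurrence hν hx]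
  ring

/-- `(x/2)^(-ν) I_ν(x) → 1/Γ(ν+1)` as `x → 0+`. -/
lemma tendsto_rpow_neg_mul_besselI {ν : ℝ} (hν : -1 < ν) :
    Tendsto (fun x => (x / 2) ^ (-ν) * besselI ν x) (𝓝[>] 0) (𝓝 (Real.Gamma (ν + 1))⁻¹) := by
  have h1 : Tendsto (fun x : ℝ => hyper (ν + 1) ((x / 2) ^ 2)) (𝓝[>] 0)
      (𝓝 (Real.Gamma (ν + 1))⁻¹) := by
    rw [← hyper_zero]
    refine (hasDerivAt_hyper (by linarith) 0).continuousAt.tendsto.comp ?_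
    have : Continuous fun x : ℝ => (x / 2) ^ 2 := by fun_prop
    simpa using (this.tendsto 0).mono_left nhdsWithin_le_nhds
  refine h1.congr' ?_
  filter_upwards [self_mem_nhdsWithin] with x hx
  have hx : 0 < x := hx
  rw [besselI_eq _ hx, ← mul_assoc, ← Real.rpow_add (by positivity)]
  simp

/-! ### Integral representation and derivatives of K. -/

lemma cosh_le_exp_abs (u : ℝ) : Real.cosh u ≤ Real.exp |u| := by
  rw [← Real.cosh_abs, Real.cosh_eq]
  have := Real.exp_le_exp.2 (show -|u| ≤ |u| by linarith [abs_nonneg u])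
  linarith

lemma abs_sinh_le_exp_abs (u : ℝ) : |Real.sinh u| ≤ Real.exp |u| := by
  rw [Real.abs_sinh]
  exact (Real.sinh_lt_cosh _).le.trans (by simpa using cosh_le_exp_abs |u|)

/-- Use cosh u ≥ u²/4 and complete the square in u. -/
lemma exp_neg_mul_cosh_mul_exp_le {x : ℝ} (hx : 0 < x) (c : ℝ) {u : ℝ} (hu : 0 ≤ u) :
    Real.exp (-x * Real.cosh u) * Real.exp (c * u) ≤
      Real.exp ((c + 1) ^ 2 / x) * Real.exp (-1 * u) := by
  rw [← Real.exp_add, ← Real.exp_add, Real.exp_le_exp]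
  have h1 : u ^ 2 / 4 ≤ Real.cosh u := by
    rw [Real.cosh_eq]
    have := Real.quadratic_le_exp_of_nonneg hu
    have := Real.exp_pos (-u)
    linarith
  have h2 : x * (u ^ 2 / 4) ≤ x * Real.cosh u := by gcongr
  have h3 : (c + 1) ^ 2 / x - (c + 1) * u + x * (u ^ 2 / 4) = (c + 1 - x * u / 2) ^ 2 / x := by
    field_simp; ring
  have h4 : 0 ≤ (c + 1 - x * u / 2) ^ 2 / x := by positivity
  linarith

lemma integrableOn_exp_neg_mul_cosh_mul {x : ℝ} (hx : 0 < x) {f : ℝ → ℝ} (hf : Continuous f)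
    (c : ℝ) (hfc : ∀ u, 0 ≤ u → |f u| ≤ Real.exp (c * u)) :
    IntegrableOn (fun u => Real.exp (-x * Real.cosh u) * f u) (Set.Ioi 0) := by
  refine integrable_of_isBigO_exp_neg one_pos (by fun_prop)
    (Asymptotics.IsBigO.of_bound (Real.exp ((c + 1) ^ 2 / x)) ?_)
  filter_upwards [eventually_ge_atTop 0] with u hu
  rw [norm_mul, Real.norm_eq_abs, Real.norm_eq_abs, Real.norm_eq_abs, Real.abs_exp, Real.abs_exp]
  refine le_trans ?_ (exp_neg_mul_cosh_mul_exp_le hx c hu)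
  gcongr
  exact hfc u hu

lemma abs_cosh_mul_le (ν : ℝ) {u : ℝ} (hu : 0 ≤ u) :
    |Real.cosh (ν * u)| ≤ Real.exp (|ν| * u) := by
  rw [abs_of_pos (Real.cosh_pos _), ← abs_of_nonneg hu, ← abs_mul, abs_of_nonneg hu]
  exact cosh_le_exp_abs _

lemma abs_sinh_mul_le (ν : ℝ) {u : ℝ} (hu : 0 ≤ u) :
    |Real.sinh (ν * u)| ≤ Real.exp (|ν| * u) := by
  rw [← abs_of_nonneg hu, ← abs_mul, abs_of_nonneg hu]
  exact abs_sinh_le_exp_abs _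

lemma integrableOn_besselK {x : ℝ} (hx : 0 < x) (ν : ℝ) :
    IntegrableOn (fun u => Real.exp (-x * Real.cosh u) * Real.cosh (ν * u)) (Set.Ioi 0) :=
  integrableOn_exp_neg_mul_cosh_mul hx (by fun_prop) |ν| fun _ hu => abs_cosh_mul_le ν hu

lemma integrableOn_cosh_mul_cosh {x : ℝ} (hx : 0 < x) (ν : ℝ) :
    IntegrableOn (fun u => Real.exp (-x * Real.cosh u) * (Real.cosh u * Real.cosh (ν * u)))
      (Set.Ioi 0) :=
  integrableOn_exp_neg_mul_cosh_mul hx (by fun_prop) (1 + |ν|) fun u hu => by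
    rw [abs_mul, add_mul, Real.exp_add]
    gcongr
    · simpa using abs_cosh_mul_le 1 hu
    · exact abs_cosh_mul_le ν hu

lemma integrableOn_sinh_mul_sinh {x : ℝ} (hx : 0 < x) (ν : ℝ) :
    IntegrableOn (fun u => Real.exp (-x * Real.cosh u) * (Real.sinh u * Real.sinh (ν * u)))
      (Set.Ioi 0) :=
  integrableOn_exp_neg_mul_cosh_mul hx (by fun_prop) (1 + |ν|) fun u hu => by
    rw [abs_mul, add_mul, Real.exp_add]
    gcongr
    · simpa using abs_sinh_mul_le 1 hu
    · exact abs_sinh_mul_le ν hu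

/-- Integration by parts: exp(-x cosh u) sinh(νu) vanishes at 0 and at infinity. -/
lemma integral_sinh_mul_sinh {x : ℝ} (hx : 0 < x) (ν : ℝ) :
    ∫ u in Set.Ioi (0 : ℝ), Real.exp (-x * Real.cosh u) * (Real.sinh u * Real.sinh (ν * u)) =
      ν / x * besselK ν x := by
  have hd : ∀ u ∈ Set.Ici (0 : ℝ),
      HasDerivAt (fun u => Real.exp (-x * Real.cosh u) * Real.sinh (ν * u))
        (ν * (Real.exp (-x * Real.cosh u) * Real.cosh (ν * u)) -
          x * (Real.exp (-x * Real.cosh u) * (Real.sinh u * Real.sinh (ν * u)))) u := by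
    intro u _
    refine ((((Real.hasDerivAt_cosh u).const_mul (-x)).exp).mul
      (((hasDerivAt_id u).const_mul ν).sinh)).congr_deriv ?_
    simp only [id]
    ring
  have hi1 := (integrableOn_besselK hx ν).const_mul ν
  have hi2 := (integrableOn_sinh_mul_sinh hx ν).const_mul x
  have hlim : Tendsto (fun u => Real.exp (-x * Real.cosh u) * Real.sinh (ν * u)) atTop (𝓝 0) := by
    have h0 : Tendsto (fun u : ℝ => Real.exp ((|ν| + 1) ^ 2 / x) * Real.exp (-1 * u)) atTop
        (𝓝 0) := by
      have : Tendsto (fun u : ℝ => Real.exp (-1 * u)) atTop (𝓝 0) := by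
        simpa using Real.tendsto_exp_neg_atTop_nhds_zero
      simpa using this.const_mul (Real.exp ((|ν| + 1) ^ 2 / x))
    refine squeeze_zero_norm' ?_ h0
    filter_upwards [eventually_ge_atTop 0] with u hu
    rw [norm_mul, Real.norm_eq_abs, Real.norm_eq_abs, Real.abs_exp]
    refine le_trans ?_ (exp_neg_mul_cosh_mul_exp_le hx |ν| hu)
    gcongr
    exact abs_sinh_mul_le ν hu
  have key := integral_Ioi_of_hasDerivAt_of_tendsto' hd (hi1.sub hi2) hlim
  rw [integral_sub hi1 hi2, integral_const_mul, integral_const_mul] at key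
  simp only [mul_zero, Real.sinh_zero, sub_zero] at key
  unfold besselK
  rw [div_mul_eq_mul_div, eq_div_iff hx.ne']
  linarith

lemma besselK_neg (ν x : ℝ) : besselK (-ν) x = besselK ν x := by
  simp [besselK]

lemma besselK_sub_one {x : ℝ} (hx : 0 < x) (ν : ℝ) :
    besselK (ν - 1) x =
      (∫ u in Set.Ioi (0 : ℝ), Real.exp (-x * Real.cosh u) * (Real.cosh u * Real.cosh (ν * u))) -
        ν / x * besselK ν x := by
  rw [← integral_sinh_mul_sinh hx ν,
    ← integral_sub (integrableOn_cosh_mul_cosh hx ν) (integrableOn_sinh_mul_sinh hx ν), besselK]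
  congr 1
  ext u
  rw [show (ν - 1) * u = ν * u - u by ring, Real.cosh_sub]
  ring

lemma hasDerivAt_besselK_sub {x : ℝ} (hx : 0 < x) (ν : ℝ) :
    HasDerivAt (besselK ν) (-besselK (ν - 1) x - ν / x * besselK ν x) x := by
  have key := (hasDerivAt_integral_of_dominated_loc_of_deriv_le
    (μ := volume.restrict (Set.Ioi (0 : ℝ)))
    (F := fun x u => Real.exp (-x * Real.cosh u) * Real.cosh (ν * u))
    (F' := fun x u => -(Real.exp (-x * Real.cosh u) * (Real.cosh u * Real.cosh (ν * u))))
    -- For y > x/2 the integrand decreases in y, so its value at x/2 dominates.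
    (bound := fun u => Real.exp (-(x / 2) * Real.cosh u) * (Real.cosh u * Real.cosh (ν * u)))
    (x₀ := x) (s := Set.Ioi (x / 2)) (Ioi_mem_nhds (by linarith))
    (Eventually.of_forall fun y => by
      have : Continuous fun u => Real.exp (-y * Real.cosh u) * Real.cosh (ν * u) := by fun_prop
      exact this.aestronglyMeasurable)
    (integrableOn_besselK hx ν)
    (by
      have : Continuous fun u =>
        -(Real.exp (-x * Real.cosh u) * (Real.cosh u * Real.cosh (ν * u))) := by fun_prop
      exact this.aestronglyMeasurable)
    (Eventually.of_forall fun u y hy => by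
      have hy : x / 2 < y := hy
      have h1 := Real.cosh_pos u
      have h2 := Real.cosh_pos (ν * u)
      rw [norm_neg, Real.norm_eq_abs, abs_of_nonneg (by positivity)]
      gcongr)
    (integrableOn_cosh_mul_cosh (by positivity) ν)
    (Eventually.of_forall fun u y _ => by
      refine ((((hasDerivAt_id y).neg.mul_const (Real.cosh u)).exp).mul_const
        (Real.cosh (ν * u))).congr_deriv ?_
      simp only [Pi.neg_apply, id]
      ring)).2
  refine key.congr_deriv ?_
  rw [integral_neg, besselK_sub_one hx]
  ring

lemma hasDerivAt_besselK_add {x : ℝ} (hx : 0 < x) (ν : ℝ) :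
    HasDerivAt (besselK ν) (ν / x * besselK ν x - besselK (ν + 1) x) x := by
  have h : besselK (-ν) = besselK ν := funext (besselK_neg ν)
  have := hasDerivAt_besselK_sub hx (-ν)
  rw [h, show -ν - 1 = -(ν + 1) by ring, besselK_neg] at this
  refine this.congr_deriv ?_
  ring

/-! ### Size of K and its behaviour at 0+. -/

lemma besselK_nonneg (ν x : ℝ) : 0 ≤ besselK ν x :=
  integral_nonneg fun u => by have := Real.cosh_pos (ν * u); positivity

lemma besselK_le_of_abs_le {x μ ν : ℝ} (hx : 0 < x) (h : |μ| ≤ |ν|) :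
    besselK μ x ≤ besselK ν x := by
  refine integral_mono (integrableOn_besselK hx μ) (integrableOn_besselK hx ν) fun u => ?_
  have : Real.cosh (μ * u) ≤ Real.cosh (ν * u) := by
    rw [Real.cosh_le_cosh, abs_mul, abs_mul]
    gcongr
  dsimp only
  gcongr

lemma integrableOn_exp_neg_mul_cosh_mul_exp {x : ℝ} (hx : 0 < x) (ν : ℝ) :
    IntegrableOn (fun u => Real.exp (-x * Real.cosh u) * Real.exp (ν * u)) (Set.Ioi 0) :=
  integrableOn_exp_neg_mul_cosh_mul hx (by fun_prop) ν fun u _ => by rw [Real.abs_exp]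

/-- The substitution `t = (x/2) e^u`. -/
lemma rpow_mul_integral_exp_neg_mul_cosh {x ν : ℝ} (hx : 0 < x) (hν : 0 < ν) :
    (x / 2) ^ ν * ∫ u in Set.Ioi (0 : ℝ), Real.exp (-x * Real.cosh u) * Real.exp (ν * u) =
      ∫ t in Set.Ioi (x / 2), Real.exp (-t) * t ^ (ν - 1) * Real.exp (-(x / 2) ^ 2 / t) := by
  have hx2 : 0 < x / 2 := by positivity
  have hcont : ContinuousOn
      (fun t : ℝ => Real.exp (-t) * t ^ (ν - 1) * Real.exp (-(x / 2) ^ 2 / t)) (Set.Ioi 0) := by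
    intro t ht
    have ht : t ≠ 0 := (Set.mem_Ioi.1 ht).ne'
    refine ContinuousAt.continuousWithinAt ?_
    have := Real.continuousAt_rpow_const t (ν - 1) (Or.inl ht)
    fun_prop (disch := assumption)
  have himg : (fun u : ℝ => x / 2 * Real.exp u) '' Set.Ici 0 ⊆ Set.Ioi 0 := by
    rintro _ ⟨u, _, rfl⟩
    exact mul_pos hx2 (Real.exp_pos u)
  have hpt : ∀ u : ℝ, ((fun t : ℝ => Real.exp (-t) * t ^ (ν - 1) * Real.exp (-(x / 2) ^ 2 / t)) ∘
      fun u : ℝ => x / 2 * Real.exp u) u * (x / 2 * Real.exp u) =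
      (x / 2) ^ ν * (Real.exp (-x * Real.cosh u) * Real.exp (ν * u)) := by
    intro u
    have hp : 0 < x / 2 * Real.exp u := mul_pos hx2 (Real.exp_pos u)
    simp only [Function.comp]
    rw [Real.rpow_sub_one hp.ne', Real.mul_rpow hx2.le (Real.exp_pos u).le, ← Real.exp_mul,
      Real.cosh_eq]
    -- With t = (x/2) e^u, x cosh u = t + (x/2)²/t.
    have : Real.exp (-x * ((Real.exp u + Real.exp (-u)) / 2)) =
        Real.exp (-(x / 2 * Real.exp u)) * Real.exp (-(x / 2) ^ 2 / (x / 2 * Real.exp u)) := by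
      rw [← Real.exp_add, Real.exp_neg u]
      congr 1
      field_simp
      ring
    rw [this, mul_comm ν u]
    field_simp
  have key := integral_comp_mul_deriv_Ioi (f := fun u : ℝ => x / 2 * Real.exp u)
    (f' := fun u : ℝ => x / 2 * Real.exp u)
    (g := fun t : ℝ => Real.exp (-t) * t ^ (ν - 1) * Real.exp (-(x / 2) ^ 2 / t)) (a := 0)
    (by fun_prop) (Real.tendsto_exp_atTop.const_mul_atTop hx2)
    (fun u _ => ((Real.hasDerivAt_exp u).const_mul (x / 2)).hasDerivWithinAt)
    (hcont.mono ((Set.image_mono Set.Ioi_subset_Ici_self).trans himg))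
    (by
      refine IntegrableOn.mono_set ?_ himg
      refine Integrable.mono' (Real.GammaIntegral_convergent hν)
        (hcont.aestronglyMeasurable measurableSet_Ioi) ?_
      filter_upwards [ae_restrict_mem measurableSet_Ioi] with t ht
      have ht : 0 < t := ht
      rw [Real.norm_eq_abs, abs_of_nonneg (by positivity)]
      refine mul_le_of_le_one_right (by positivity) (Real.exp_le_one_iff.2 ?_)
      rw [neg_div]
      have : 0 ≤ (x / 2) ^ 2 / t := by positivity
      linarith)
    (by
      simp only [hpt]
      rw [integrableOn_Ici_iff_integrableOn_Ioi]
      exact (integrableOn_exp_neg_mul_cosh_mul_exp hx ν).const_mul _)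
  simp only [hpt] at key
  rw [integral_const_mul, Real.exp_zero, mul_one] at key
  exact key

/-- Dominated convergence, with the integrand of Γ(ν) as majorant. -/
lemma tendsto_integral_Gamma {ν : ℝ} (hν : 0 < ν) :
    Tendsto (fun x : ℝ => ∫ t in Set.Ioi (x / 2),
      Real.exp (-t) * t ^ (ν - 1) * Real.exp (-(x / 2) ^ 2 / t)) (𝓝[>] 0)
      (𝓝 (Real.Gamma ν)) := by
  rw [Real.Gamma_eq_integral hν]
  have h1 : (fun x : ℝ => ∫ t in Set.Ioi (x / 2),
      Real.exp (-t) * t ^ (ν - 1) * Real.exp (-(x / 2) ^ 2 / t)) =ᶠ[𝓝[>] 0]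
      fun x => ∫ t in Set.Ioi (0 : ℝ), (Set.Ioi (x / 2)).indicator
        (fun t => Real.exp (-t) * t ^ (ν - 1) * Real.exp (-(x / 2) ^ 2 / t)) t := by
    filter_upwards [self_mem_nhdsWithin] with x hx
    have hx : 0 < x := hx
    rw [setIntegral_indicator measurableSet_Ioi, Set.inter_eq_right.2]
    exact Set.Ioi_subset_Ioi (by positivity)
  refine Tendsto.congr' h1.symm ?_
  refine tendsto_integral_filter_of_dominated_convergence
    (fun t => Real.exp (-t) * t ^ (ν - 1)) ?_ ?_ (Real.GammaIntegral_convergent hν) ?_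
  · refine Eventually.of_forall fun x => ?_
    refine (Measurable.indicator ?_ measurableSet_Ioi).aestronglyMeasurable
    fun_prop
  · refine Eventually.of_forall fun x => ?_
    filter_upwards [ae_restrict_mem measurableSet_Ioi] with t ht
    have ht : 0 < t := ht
    refine (norm_indicator_le_norm_self _ _).trans ?_
    rw [Real.norm_eq_abs, abs_of_nonneg (by positivity)]
    refine mul_le_of_le_one_right (by positivity) (Real.exp_le_one_iff.2 ?_)
    rw [neg_div]
    have : 0 ≤ (x / 2) ^ 2 / t := by positivity
    linarith
  · filter_upwards [ae_restrict_mem measurableSet_Ioi] with t ht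
    have ht : 0 < t := ht
    have h2 : Tendsto (fun x : ℝ => Real.exp (-t) * t ^ (ν - 1) * Real.exp (-(x / 2) ^ 2 / t))
        (𝓝[>] 0) (𝓝 (Real.exp (-t) * t ^ (ν - 1))) := by
      have : Continuous fun x : ℝ =>
        Real.exp (-t) * t ^ (ν - 1) * Real.exp (-(x / 2) ^ 2 / t) := by fun_prop
      simpa using (this.tendsto 0).mono_left nhdsWithin_le_nhds
    refine h2.congr' ?_
    have : ∀ᶠ x : ℝ in 𝓝[>] 0, x < 2 * t :=
      nhdsWithin_le_nhds (gt_mem_nhds (by positivity))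
    filter_upwards [this] with x hx
    rw [Set.indicator_of_mem]
    exact Set.mem_Ioi.2 (by linarith)

lemma tendsto_rpow_nhdsGT_zero {ν : ℝ} (hν : 0 < ν) :
    Tendsto (fun x : ℝ => (x / 2) ^ ν) (𝓝[>] 0) (𝓝 0) := by
  have : Continuous fun x : ℝ => (x / 2) ^ ν :=
    (continuous_id.div_const 2).rpow_const fun _ => Or.inr hν.le
  simpa [Real.zero_rpow hν.ne'] using (this.tendsto 0).mono_left nhdsWithin_le_nhds

/-- `(x/2)^ν K_ν(x) → Γ(ν)/2` as `x → 0+`. -/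
lemma tendsto_rpow_mul_besselK {ν : ℝ} (hν : 0 < ν) :
    Tendsto (fun x => (x / 2) ^ ν * besselK ν x) (𝓝[>] 0) (𝓝 (Real.Gamma ν / 2)) := by
  -- Of the two exponentials in cosh(νu), the decaying one contributes nothing in the limit.
  have hB : Tendsto (fun x : ℝ => (x / 2) ^ ν *
      ∫ u in Set.Ioi (0 : ℝ), Real.exp (-x * Real.cosh u) * Real.exp (-ν * u))
      (𝓝[>] 0) (𝓝 0) := by
    have h0 := (tendsto_rpow_nhdsGT_zero hν).mul_const
      (∫ u in Set.Ioi (0 : ℝ), Real.exp (-ν * u))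
    rw [zero_mul] at h0
    refine squeeze_zero' ?_ ?_ h0
    · filter_upwards [self_mem_nhdsWithin] with x hx
      have hx : 0 < x := hx
      exact mul_nonneg (by positivity) (integral_nonneg fun u => by positivity)
    · filter_upwards [self_mem_nhdsWithin] with x hx
      have hx : 0 < x := hx
      gcongr
      · exact integrableOn_exp_neg_mul_cosh_mul_exp hx (-ν)
      · exact exp_neg_integrableOn_Ioi 0 hν
      · exact measurableSet_Ioi.nullMeasurableSet
      · rename_i u _
        refine mul_le_of_le_one_left (by positivity) (Real.exp_le_one_iff.2 ?_)
        have := Real.cosh_pos u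
        nlinarith
  have h := ((tendsto_integral_Gamma hν).add hB).div_const 2
  rw [add_zero] at h
  refine h.congr' ?_
  filter_upwards [self_mem_nhdsWithin] with x hx
  have hx : 0 < x := hx
  rw [← rpow_mul_integral_exp_neg_mul_cosh hx hν, ← mul_add,
    ← integral_add (integrableOn_exp_neg_mul_cosh_mul_exp hx ν)
      (integrableOn_exp_neg_mul_cosh_mul_exp hx (-ν)), mul_div_assoc, ← integral_div, besselK]
  congr 2
  ext u
  rw [Real.cosh_eq (ν * u), neg_mul ν u]
  ring

/-! ### The Wronskian of I and K. -/

lemma tendsto_mul_besselI_mul_besselK {ν : ℝ} (hν : 1 / 2 ≤ ν) :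
    Tendsto (fun x => x * (besselI (ν - 1) x * besselK ν x + besselK (ν - 1) x * besselI ν x))
      (𝓝[>] 0) (𝓝 1) := by
  have hν0 : 0 < ν := by linarith
  have hK := tendsto_rpow_mul_besselK hν0
  have h1 := (tendsto_rpow_neg_mul_besselI (show -1 < ν - 1 by linarith)).mul hK
  have hx0 : Tendsto (fun x : ℝ => x / 2) (𝓝[>] 0) (𝓝 0) := by
    have : Continuous fun x : ℝ => x / 2 := by fun_prop
    simpa using (this.tendsto 0).mono_left nhdsWithin_le_nhds
  have h2 : Tendsto (fun x => x / 2 * ((x / 2) ^ ν * besselK (ν - 1) x)) (𝓝[>] 0) (𝓝 0) := by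
    have h0 := hx0.mul hK
    rw [zero_mul] at h0
    refine squeeze_zero' ?_ ?_ h0
    · filter_upwards [self_mem_nhdsWithin] with x hx
      have hx : 0 < x := hx
      have := besselK_nonneg (ν - 1) x
      positivity
    · filter_upwards [self_mem_nhdsWithin] with x hx
      have hx : 0 < x := hx
      gcongr
      -- ν ≥ 1/2 is exactly what gives |ν - 1| ≤ ν.
      refine besselK_le_of_abs_le hx ?_
      rw [abs_of_pos hν0, abs_le]
      constructor <;> linarith
  have h3 := h2.mul (tendsto_rpow_neg_mul_besselI (show -1 < ν by linarith))
  have h4 := (h1.add h3).const_mul 2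
  have hG := (Real.Gamma_pos_of_pos hν0).ne'
  have e : 2 * ((Real.Gamma (ν - 1 + 1))⁻¹ * (Real.Gamma ν / 2) +
      0 * (Real.Gamma (ν + 1))⁻¹) = 1 := by
    rw [sub_add_cancel]; field_simp; ring
  rw [e] at h4
  refine h4.congr' ?_
  filter_upwards [self_mem_nhdsWithin] with x hx
  have hx : 0 < x := hx
  rw [neg_sub, sub_eq_add_neg, Real.rpow_add (by positivity), Real.rpow_one,
    Real.rpow_neg (by positivity)]
  field_simp

/-- The Wronskian relation for modified Bessel functions. -/
lemma mul_besselI_mul_besselK {ν x : ℝ} (hν : 1 / 2 ≤ ν) (hx : 0 < x) :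
    x * (besselI (ν - 1) x * besselK ν x + besselK (ν - 1) x * besselI ν x) = 1 := by
  set W : ℝ → ℝ := fun x =>
    x * (besselI (ν - 1) x * besselK ν x + besselK (ν - 1) x * besselI ν x) with hW
  have hd : ∀ y ∈ Set.Ioi (0 : ℝ), HasDerivAt W 0 y := by
    intro y hy
    have hy : 0 < y := hy
    refine ((hasDerivAt_id y).mul
      (((hasDerivAt_besselI_add (show -1 < ν - 1 by linarith) hy).mul
        (hasDerivAt_besselK_sub hy ν)).add
      ((hasDerivAt_besselK_add hy (ν - 1)).mul
        (hasDerivAt_besselI_sub (show 0 < ν by linarith) hy)))).congr_deriv ?_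
    simp only [id, sub_add_cancel, Pi.add_apply, Pi.mul_apply]
    field_simp
    ring
  have hc : ∀ y ∈ Set.Ioi (0 : ℝ), W y = W x := fun y hy =>
    isOpen_Ioi.is_const_of_deriv_eq_zero (convex_Ioi 0).isPreconnected
      (fun z hz => (hd z hz).differentiableAt.differentiableWithinAt)
      (fun z hz => (hd z hz).deriv) hy hx
  have hl : Tendsto W (𝓝[>] 0) (𝓝 (W x)) :=
    tendsto_const_nhds.congr' (by
      filter_upwards [self_mem_nhdsWithin] with y hy using (hc y hy).symm)
  exact tendsto_nhds_unique hl (tendsto_mul_besselI_mul_besselK hν)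

/-! ### Change of variable and the explicit solutions. -/

lemma half_le_nu {k : ℝ} (hk0 : 0 ≤ k) (hk1 : k < 1) : 1 / 2 ≤ nu k := by
  unfold nu
  have : 0 < 1 - k := by linarith
  rw [div_le_div_iff₀ (by norm_num) (by positivity)]
  linarith

lemma phi_eq {t : ℝ} (k : ℝ) (ht : 0 < t) : phi k t = t * t ^ (-k) / (1 - k) := by
  rw [phi, sub_eq_add_neg, Real.rpow_add ht, Real.rpow_one]

lemma phi_pos {k t : ℝ} (hk1 : k < 1) (ht : 0 < t) : 0 < phi k t := by
  have : 0 < 1 - k := by linarith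
  unfold phi
  positivity

lemma hasDerivAt_phi {k t : ℝ} (hk1 : k < 1) (ht : 0 < t) :
    HasDerivAt (phi k) (t ^ (-k)) t := by
  have h : 1 - k ≠ 0 := by linarith
  refine ((Real.hasDerivAt_rpow_const (p := 1 - k) (Or.inl ht.ne')).div_const _).congr_deriv ?_
  rw [show 1 - k - 1 = -k by ring]
  field_simp

lemma hasDerivAt_comp_phi {lam k t : ℝ} (hk1 : k < 1) (ht : 0 < t) {Z : ℝ → ℝ} {z' : ℝ}
    (hZ : HasDerivAt Z z' (lam * phi k t)) :
    HasDerivAt (fun t => Z (lam * phi k t)) (z' * (lam * t ^ (-k))) t :=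
  HasDerivAt.comp (h₂ := Z) (h := fun t => lam * phi k t) t hZ
    ((hasDerivAt_phi hk1 ht).const_mul lam)

/-- Since φ'/φ = (1-k)/t and ν(1-k) = 1/2, the derivative of t^(1/2) cancels the term -(ν/x) Z. -/
lemma hasDerivAt_sqrt_mul {lam k t σ : ℝ} (hk1 : k < 1) (hlam : 0 < lam) (ht : 0 < t)
    {Z Z₁ : ℝ → ℝ} (hZ : ∀ x, 0 < x → HasDerivAt Z (σ * Z₁ x - nu k / x * Z x) x) :
    HasDerivAt (fun t => t ^ (1 / 2 : ℝ) * Z (lam * phi k t))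
      (σ * (lam * t ^ (1 / 2 - k) * Z₁ (lam * phi k t))) t := by
  have hφ := phi_pos hk1 ht
  refine ((Real.hasDerivAt_rpow_const (p := 1 / 2) (Or.inl ht.ne')).mul
    (hasDerivAt_comp_phi hk1 ht (hZ _ (mul_pos hlam hφ)))).congr_deriv ?_
  generalize Z (lam * phi k t) = a
  generalize Z₁ (lam * phi k t) = b
  have h1 : 1 - k ≠ 0 := by linarith
  have h2 : t ^ (-k) ≠ 0 := (Real.rpow_pos_of_pos ht _).ne'
  rw [phi_eq k ht, nu, Real.rpow_sub_one ht.ne', sub_eq_add_neg (1 / 2 : ℝ) k, Real.rpow_add ht]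
  field_simp
  ring

/-- Here (1/2 - k) + (ν - 1)(1 - k) = 0 removes the Z₁ terms. -/
lemma hasDerivAt_rpow_mul {lam k t σ : ℝ} (hk1 : k < 1) (hlam : 0 < lam) (ht : 0 < t)
    {Z Z₁ : ℝ → ℝ} (hZ : ∀ x, 0 < x → HasDerivAt Z₁ ((nu k - 1) / x * Z₁ x + σ * Z x) x) :
    HasDerivAt (fun t => lam * t ^ (1 / 2 - k) * Z₁ (lam * phi k t))
      (σ * (lam ^ 2 * t ^ (-2 * k) * (t ^ (1 / 2 : ℝ) * Z (lam * phi k t)))) t := by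
  have hφ := phi_pos hk1 ht
  refine (((Real.hasDerivAt_rpow_const (p := 1 / 2 - k) (Or.inl ht.ne')).const_mul lam).mul
    (hasDerivAt_comp_phi hk1 ht (hZ _ (mul_pos hlam hφ)))).congr_deriv ?_
  generalize Z (lam * phi k t) = a
  generalize Z₁ (lam * phi k t) = b
  have h1 : 1 - k ≠ 0 := by linarith
  have h2 : t ^ (-k) ≠ 0 := (Real.rpow_pos_of_pos ht _).ne'
  rw [phi_eq k ht, nu, Real.rpow_sub_one ht.ne', sub_eq_add_neg (1 / 2 : ℝ) k, Real.rpow_add ht,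
    show -2 * k = -k + -k by ring, Real.rpow_add ht]
  field_simp
  ring

/-- The functions `A t^(1/2) I_ν(λφ(t)) + B t^(1/2) K_ν(λφ(t))` solve the equation. -/
lemma isCauchySolution_bessel {lam k s : ℝ} (hk0 : 0 ≤ k) (hk1 : k < 1) (hlam : 0 < lam)
    (hs : 0 < s) (A B : ℝ) {y : ℝ → ℝ} {a b : ℝ}
    (hy : ∀ t, 0 < t → y t = t ^ (1 / 2 : ℝ) *
      (A * besselI (nu k) (lam * phi k t) + B * besselK (nu k) (lam * phi k t)))
    (ha : y s = a)
    (hb : lam * s ^ (1 / 2 - k) *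
      (A * besselI (nu k - 1) (lam * phi k s) - B * besselK (nu k - 1) (lam * phi k s)) = b) :
    IsCauchySolution lam k s a b y := by
  have hν := half_le_nu hk0 hk1
  let Z : ℝ → ℝ := fun x => A * besselI (nu k) x + B * besselK (nu k) x
  let Z₁ : ℝ → ℝ := fun x => A * besselI (nu k - 1) x - B * besselK (nu k - 1) x
  have hZ : ∀ x, 0 < x → HasDerivAt Z (1 * Z₁ x - nu k / x * Z x) x := fun x hx => by
    refine (((hasDerivAt_besselI_sub (show 0 < nu k by linarith) hx).const_mul A).add
      ((hasDerivAt_besselK_sub hx (nu k)).const_mul B)).congr_deriv ?_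
    simp only [Z, Z₁]
    ring
  have hZ₁ : ∀ x, 0 < x → HasDerivAt Z₁ ((nu k - 1) / x * Z₁ x + 1 * Z x) x := fun x hx => by
    refine (((hasDerivAt_besselI_add (show -1 < nu k - 1 by linarith) hx).const_mul A).sub
      ((hasDerivAt_besselK_add hx (nu k - 1)).const_mul B)).congr_deriv ?_
    simp only [Z, Z₁, sub_add_cancel]
    ring
  have hd1 : ∀ t, 0 < t → HasDerivAt y (lam * t ^ (1 / 2 - k) * Z₁ (lam * phi k t)) t := by
    intro t ht
    refine ((hasDerivAt_sqrt_mul hk1 hlam ht hZ).congr_of_eventuallyEq ?_).congr_deriv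
      (one_mul _)
    filter_upwards [lt_mem_nhds ht] with r hr using hy r hr
  have hd2 : ∀ t, 0 < t → HasDerivAt (fun t => lam * t ^ (1 / 2 - k) * Z₁ (lam * phi k t))
      (lam ^ 2 * t ^ (-2 * k) * y t) t := by
    intro t ht
    refine (hasDerivAt_rpow_mul hk1 hlam ht hZ₁).congr_deriv ?_
    rw [hy t ht, one_mul]
  refine ⟨_, _, fun t ht => (hd1 t (hs.trans_le ht)).hasDerivWithinAt,
    fun t ht => (hd2 t (hs.trans_le ht)).continuousAt.continuousWithinAt,
    fun t ht => hd2 t (hs.trans ht), fun t _ => sub_self _, ha, hb⟩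

/-- The coefficients make the slope at s cancel identically; the value at s is the Bessel Wronskian.
-/
lemma isCauchySolution_y0 {lam k s : ℝ} (hk0 : 0 ≤ k) (hk1 : k < 1) (hlam : 0 < lam)
    (hs : 0 < s) : IsCauchySolution lam k s 1 0 (y0 lam k s) := by
  have h := mul_besselI_mul_besselK (half_le_nu hk0 hk1) (mul_pos hlam (phi_pos hk1 hs))
  refine isCauchySolution_bessel hk0 hk1 hlam hs
    (lam * phi k s / s ^ (1 / 2 : ℝ) * besselK (nu k - 1) (lam * phi k s))
    (lam * phi k s / s ^ (1 / 2 : ℝ) * besselI (nu k - 1) (lam * phi k s)) ?_ ?_ ?_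
  · intro t ht
    rw [y0, Real.div_rpow ht.le hs.le]
    ring
  · rw [y0, div_self hs.ne', Real.one_rpow]
    linarith
  · ring

lemma isCauchySolution_y1 {lam k s : ℝ} (hk0 : 0 ≤ k) (hk1 : k < 1) (hlam : 0 < lam)
    (hs : 0 < s) : IsCauchySolution lam k s 0 1 (y1 lam k s) := by
  have h := mul_besselI_mul_besselK (half_le_nu hk0 hk1) (mul_pos hlam (phi_pos hk1 hs))
  refine isCauchySolution_bessel hk0 hk1 hlam hs
    ((1 - k)⁻¹ * s ^ (1 / 2 : ℝ) * besselK (nu k) (lam * phi k s))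
    (-((1 - k)⁻¹ * s ^ (1 / 2 : ℝ) * besselI (nu k) (lam * phi k s))) ?_ ?_ ?_
  · intro t ht
    rw [y1, Real.mul_rpow hs.le ht.le]
    ring
  · rw [y1]
    ring
  -- This turns λ s^(1/2-k) s^(1/2) / (1-k) into λφ(s), so the slope at s is the Bessel Wronskian.
  · have e : s ^ (1 / 2 - k) * s ^ (1 / 2 : ℝ) = s * s ^ (-k) := by
      rw [← Real.rpow_add hs, ← Real.rpow_one_add' hs.le (by linarith)]
      ring_nf
    refine Eq.trans ?_ h
    conv_rhs => enter [1]; rw [phi_eq k hs, ← e]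
    ring

/-! ### Uniqueness. -/

/-- The Wronskian of two solutions is constant. -/
lemma IsCauchySolution.wronskian {lam k s a b c d t : ℝ} {y u y' y'' u' u'' : ℝ → ℝ}
    (hy : ∀ t, s ≤ t → HasDerivWithinAt y (y' t) (Set.Ici s) t) (hy' : ContinuousOn y' (Set.Ici s))
    (hy'' : ∀ t, s < t → HasDerivAt y' (y'' t) t)
    (hey : ∀ t, s < t → y'' t - lam ^ 2 * t ^ (-2 * k) * y t = 0) (ha : y s = a) (hb : y' s = b)
    (hu : ∀ t, s ≤ t → HasDerivWithinAt u (u' t) (Set.Ici s) t) (hu' : ContinuousOn u' (Set.Ici s))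
    (hu'' : ∀ t, s < t → HasDerivAt u' (u'' t) t)
    (heu : ∀ t, s < t → u'' t - lam ^ 2 * t ^ (-2 * k) * u t = 0) (hc : u s = c) (hd : u' s = d)
    (hst : s ≤ t) :
    y t * u' t - y' t * u t = a * d - b * c := by
  rw [← ha, ← hb, ← hc, ← hd]
  rcases hst.eq_or_lt with rfl | hlt
  · rfl
  have hcont : ContinuousOn (fun t => y t * u' t - y' t * u t) (Set.Icc s t) := by
    have h1 : ContinuousOn y (Set.Ici s) := fun r hr => (hy r hr).continuousWithinAt
    have h2 : ContinuousOn u (Set.Ici s) := fun r hr => (hu r hr).continuousWithinAt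
    exact ((h1.mul hu').sub (hy'.mul h2)).mono Set.Icc_subset_Ici_self
  -- The mean value theorem needs only continuity at s, where no second derivative is given.
  obtain ⟨r, -, hr⟩ := exists_hasDerivAt_eq_slope (fun t => y t * u' t - y' t * u t)
    (fun _ => 0) hlt hcont (fun r hr => by
      have hsr : s < r := hr.1
      refine ((((hy r hsr.le).hasDerivAt (Ici_mem_nhds hsr)).mul (hu'' r hsr)).sub
        ((hy'' r hsr).mul ((hu r hsr.le).hasDerivAt (Ici_mem_nhds hsr)))).congr_deriv ?_
      linear_combination y r * heu r hsr - u r * hey r hsr)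
  rw [eq_div_iff (sub_pos.2 hlt).ne', zero_mul] at hr
  linarith

lemma IsCauchySolution.eqOn_of_fundamental {lam k s a b : ℝ} {y u v : ℝ → ℝ}
    (hy : IsCauchySolution lam k s a b y) (hu : IsCauchySolution lam k s 1 0 u)
    (hv : IsCauchySolution lam k s 0 1 v) :
    Set.EqOn y (fun t => a * u t + b * v t) (Set.Ici s) := by
  obtain ⟨y', y'', h1, h2, h3, h4, h5, h6⟩ := hy
  obtain ⟨u', u'', i1, i2, i3, i4, i5, i6⟩ := hu
  obtain ⟨v', v'', j1, j2, j3, j4, j5, j6⟩ := hv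
  intro t ht
  have w1 := wronskian h1 h2 h3 h4 h5 h6 i1 i2 i3 i4 i5 i6 ht
  have w2 := wronskian h1 h2 h3 h4 h5 h6 j1 j2 j3 j4 j5 j6 ht
  have w3 := wronskian i1 i2 i3 i4 i5 i6 j1 j2 j3 j4 j5 j6 ht
  dsimp only
  -- Cramer's rule: y (u v' - u' v) = u (y v' - y' v) - v (y u' - y' u), with brackets 1, a and -b.
  linear_combination (-y t) * w3 - v t * w1 + u t * w2

end EdeS

theorem proposition2p1 (k lam s : ℝ) (hk0 : 0 ≤ k) (hk1 : k < 1) (hlam : 0 < lam) (hs : 1 ≤ s) :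
    (EdeS.IsCauchySolution lam k s 1 0 (EdeS.y0 lam k s) ∧
      ∀ y : ℝ → ℝ, EdeS.IsCauchySolution lam k s 1 0 y →
        Set.EqOn y (EdeS.y0 lam k s) (Set.Ici s)) ∧
    (EdeS.IsCauchySolution lam k s 0 1 (EdeS.y1 lam k s) ∧
      ∀ y : ℝ → ℝ, EdeS.IsCauchySolution lam k s 0 1 y →
        Set.EqOn y (EdeS.y1 lam k s) (Set.Ici s)) := by
  have hs0 : 0 < s := by linarith
  have h0 := EdeS.isCauchySolution_y0 hk0 hk1 hlam hs0
  have h1 := EdeS.isCauchySolution_y1 hk0 hk1 hlam hs0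
  refine ⟨⟨h0, fun y hy t ht => ?_⟩, h1, fun y hy t ht => ?_⟩
  · simpa using hy.eqOn_of_fundamental h0 h1 ht
  · simpa using hy.eqOn_of_fundamental h0 h1 ht
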